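/- Let $q$ be a prime power, let $1\le n\le m$, and let $\mathrm{rk}(\mathbf x)$ denote the rank of $\mathbf x\in\mathrm{GF}(q^m)^n$ over $\mathrm{GF}(q)$, i.e. the rank of the $m\times n$ matrix obtained by expanding the coordinates of $\mathbf x$ in a basis of $\mathrm{GF}(q^m)$ over $\mathrm{GF}(q)$ (equivalently, the dimension of the $\mathrm{GF}(q)$-span of the coordinates). The rank distance is $d(\mathbf x,\mathbf y)=\mathrm{rk}(\mathbf x-\mathbf y)$. Let $C\subseteq\mathrm{GF}(q^m)^n$ be a (linear or nonlinear) code with at least two codewords and minimum rank distance $d_R=\min\{d(\mathbf x,\mathbf y):\mathbf x,\mathbf y\in C,\ \mathbf x\ne\mathbf y\}$, and suppose that $C$ is a maximum rank distance (MRD) code, i.e. $d_R=n-\log_{q^m}|C|+1$. Put $t=\lfloor (d_R-1)/2\rfloor$. A bounded rank distance decoder outputs, for a received word $\mathbf y\in\mathrm{GF}(q^m)^n$, a codeword of $C$ within rank distance $t$ of $\mathbf y$ if there is one, and declares a failure otherwise. Let a codeword $\mathbf c\in C$ be transmitted and $\mathbf y=\mathbf c+\mathbf e$ be received, where $\mathbf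 e$ is a random vector of $\mathrm{GF}(q^m)^n$ such that all errors of the same rank are equally likely, i.e. $\Pr(\mathbf e=\mathbf a)=\Pr(\mathbf e=\mathbf b)$ whenever $\mathrm{rk}(\mathbf a)=\mathrm{rk}(\mathbf b)$. For every $u$ with $\Pr(\mathrm{rk}(\mathbf e)=u)>0$, let $P_E(t;u)$ be the conditional probability, given $\mathrm{rk}(\mathbf e)=u$, that the decoder outputs a codeword different from $\mathbf c$. Then for every such $u$ with $u\ge d_R-t$, $$P_E(t;u)<\frac{q^{-t^2}}{K_q^{2}},\qquad K_q=\prod_{j=1}^{\infty}\left(1-q^{-j}\right).$$ -/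

import Mathlib

namespace RankMetric

section Rank

variable (K : Type*) {L : Type*} [Field K] [Field L] [Algebra K L] {n : ℕ}

/-- The rank norm over `K` of a vector `x` with coordinates in the extension field `L`:
the dimension of the `K`-span of its coordinates. By `rankNorm_eq_rank` below this is the rank
of the matrix obtained by expanding the coordinates of `x` in a basis of `L` over `K`. -/
noncomputable def rankNorm (x : Fin n → L) : ℕ :=
  Module.finrank K (Submodule.span K (Set.range x))

/-- The rank norm is the rank of the expansion matrix, for every basis of `L` over `K`. -/
theorem rankNorm_eq_rank {m : ℕ} (b : Module.Basis (Fin m) K L) (x : Fin n → L) :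
    rankNorm K x = (Matrix.of fun (i : Fin m) (j : Fin n) => b.repr (x j) i).rank := by
  rw [Matrix.rank_eq_finrank_span_cols]
  have h : Set.range (Matrix.of fun (i : Fin m) (j : Fin n) => b.repr (x j) i).col
      = (b.equivFun : L →ₗ[K] (Fin m → K)) '' Set.range x := by
    rw [← Set.range_comp]
    rfl
  rw [h, Submodule.span_image]
  exact (LinearEquiv.finrank_map_eq b.equivFun _).symm

/-- The rank metric. -/
noncomputable def rankDist (x y : Fin n → L) : ℕ :=
  rankNorm K (x - y)

/-- The minimum rank distance of a code, i.e. the minimum over all pairs of distinct codewords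
(meaningful for codes with at least two codewords). -/
noncomputable def minRankDist (C : Set (Fin n → L)) : ℕ :=
  sInf {d : ℕ | ∃ x ∈ C, ∃ y ∈ C, x ≠ y ∧ d = rankDist K x y}

/-- Maximum rank distance codes: the (linear or nonlinear) codes with at least two codewords
that attain the Singleton bound `d_R ≤ n - log_{|L|} |C| + 1`. -/
def IsMRD (C : Set (Fin n → L)) : Prop :=
  C.Nontrivial ∧
    (minRankDist K C : ℝ) = (n : ℝ) - Real.logb (Nat.card L : ℝ) (C.ncard : ℝ) + 1

/-- The error correction capability `⌊(d_R - 1) / 2⌋` of a code. -/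
noncomputable def errorCapability (C : Set (Fin n → L)) : ℕ :=
  (minRankDist K C - 1) / 2

/-- `dec` is a bounded rank distance decoder of radius `t` for `C`: on every received word `y` it
outputs a codeword within rank distance `t` of `y` if there is one, and otherwise it declares a
decoder failure (output `none`). -/
def IsBoundedRankDistDecoder (C : Set (Fin n → L)) (t : ℕ)
    (dec : (Fin n → L) → Option (Fin n → L)) : Prop :=
  ∀ y : Fin n → L,
    (∃ c ∈ C, rankDist K y c ≤ t ∧ dec y = some c) ∨
      ((∀ c ∈ C, t < rankDist K y c) ∧ dec y = none)

/-- A decoder error: the codeword `c` was transmitted, `y` was received, and the decoder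
outputs an estimate different from `c`. -/
def IsDecoderError (dec : (Fin n → L) → Option (Fin n → L)) (c y : Fin n → L) : Prop :=
  ∃ c', dec y = some c' ∧ c' ≠ c

open MeasureTheory in
/-- `μ` is the law of an error vector such that all errors of the same rank are equally likely. -/
def EquiprobableOnRanks [MeasurableSpace L] (μ : Measure (Fin n → L)) : Prop :=
  ∀ e e' : Fin n → L, rankNorm K e = rankNorm K e' → μ {e} = μ {e'}

open MeasureTheory in
/-- The decoder error probability for errors of rank `u`: the conditional probability, given that
the error `e` (of law `μ`) has rank `u`, of a decoder error when `c` is transmitted and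
`c + e` is received. -/
noncomputable def decoderErrorProb [MeasurableSpace L] (μ : Measure (Fin n → L))
    (dec : (Fin n → L) → Option (Fin n → L)) (c : Fin n → L) (u : ℕ) : ℝ :=
  (ProbabilityTheory.cond μ {e | rankNorm K e = u}).real {e | IsDecoderError dec c (c + e)}

end Rank

/-- The constant `K_q = ∏_{j ≥ 1} (1 - q^{-j})`. -/
noncomputable def Kq (q : ℕ) : ℝ :=
  ∏' j : ℕ, (1 - ((q : ℝ) ^ (j + 1))⁻¹)

/-- The infinite product defining `Kq q` converges for `q ≥ 2`. -/
theorem multipliable_Kq (q : ℕ) (hq : 2 ≤ q) :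
    Multipliable fun j : ℕ => (1 - ((q : ℝ) ^ (j + 1))⁻¹) := by
  have hq' : (2 : ℝ) ≤ q := by exact_mod_cast hq
  have hs : Summable fun j : ℕ => ‖-((q : ℝ) ^ (j + 1))⁻¹‖ := by
    have h0 : Summable fun j : ℕ => ((q : ℝ)⁻¹) ^ j :=
      summable_geometric_of_lt_one (by positivity) (inv_lt_one_of_one_lt₀ (by linarith))
    have h1 := (summable_nat_add_iff 1).2 h0
    refine h1.congr fun j => ?_
    rw [norm_neg, norm_inv, norm_pow, inv_pow, Real.norm_natCast]
  simpa [sub_eq_add_neg] using multipliable_one_add_of_summable hs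

end RankMetric

/-!
Through the standard basis, vectors of `L^n` are linear maps `V → L` with `V = K^n`, and the rank
norm becomes the rank. Write `q = |K|`, `m = dim L`, let `X` consist of the maps of the differences
`c' - c` with `c'` a codeword other than `c`, and let `V_t` be the volume of a ball of radius `t`.
An error `e` is decoded wrongly only if `x - e` has rank at most `t` for some `x ∈ X`. Only two
properties of `X` are needed: its members, and their differences, have rank at least `d = d_R`.

The errors of rank `u` are sorted by their kernel `S`, a subspace of codimension `u`. There are
`∏_{i < u} (q^m - q^i)` maps with kernel `S` (`natCard_ker_eq`). If `e` is such a map and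
`f = x - e`, then `f` and `x` agree on `S`, so the decodable `e` correspond to pairs `(f, x)` with
`f` in the ball of radius `t` and `x` in `X` agreeing on `S`.

* If `d ≤ u + 1`, then `S` lies in a subspace of dimension `n - d + 1`, to which restriction is
  injective on `X`. So every `f` has at most `q^{m(u+1-d)}` companions
  (`natCard_decodableWithKer_le_mul`).
* If `d = u + k + 1`, restriction to `S` is injective on `X`, and one has to bound the number of
  `f` in the ball whose restriction lies in `X|_S`. Among the maps on `S` with kernel `T`, those in
  `X|_S` have density at most `q^{-mk} / ∏_{j ≤ k} (1 - q^{-j})`, being determined by their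
  restriction to a subspace of codimension `k` in `S` (`natCard_domRestrict_ker_mul_le`). The
  density bound carries over to the ball, since `GL(L)` permutes the maps with kernel `T`
  transitively and preserves ranks (`natCard_domRestrict_mem_mul_le`).

In both cases the proportion of decodable maps among those with kernel `S` is at most
`V_t q^{-m(d-1)} / ∏_{j ≤ m} (1 - q^{-j})` (`natCard_decodableWithKer_mul_le_injCount`): in the
second case the extra product is absorbed by the factors with `j ≤ m - u` that are absent from
`∏_{i < u} (q^m - q^i)`, because `k + 1 = d - u ≤ m - u`.

Counting factorizations through `K^t` gives `V_t ≤ q^{t(m+n-t)} / ∏_{j ≤ t} (1 - q^{-j})`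
(`ballCard_le`). With `2t ≤ d - 1` and `n ≤ m` the powers of `q` combine to at most `q^{-t^2}`, and
every partial product of `K_q` exceeds `K_q`, which is positive.
-/

namespace RankMetric

/-! ### The partial products of `K_q` -/

/-- The partial product `∏_{1 ≤ j ≤ k} (1 - q^{-j})` of `Kq q`. -/
noncomputable def partialKq (q k : ℕ) : ℝ :=
  ∏ j ∈ Finset.range k, (1 - ((q : ℝ) ^ (j + 1))⁻¹)

theorem inv_pow_succ_lt_one {q : ℕ} (hq : 2 ≤ q) (j : ℕ) : ((q : ℝ) ^ (j + 1))⁻¹ < 1 := by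
  have hq' : (2 : ℝ) ≤ q := by exact_mod_cast hq
  exact inv_lt_one_of_one_lt₀ (one_lt_pow₀ (by linarith) (by omega))

theorem partialKq_succ (q k : ℕ) :
    partialKq q (k + 1) = partialKq q k * (1 - ((q : ℝ) ^ (k + 1))⁻¹) :=
  Finset.prod_range_succ _ _

theorem partialKq_pos {q : ℕ} (hq : 2 ≤ q) (k : ℕ) : 0 < partialKq q k :=
  Finset.prod_pos fun j _ => sub_pos.2 (inv_pow_succ_lt_one hq j)

theorem partialKq_succ_lt {q : ℕ} (hq : 2 ≤ q) (k : ℕ) : partialKq q (k + 1) < partialKq q k := by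
  rw [partialKq_succ]
  have hq' : (2 : ℝ) ≤ q := by exact_mod_cast hq
  exact mul_lt_of_lt_one_right (partialKq_pos hq k) (sub_lt_self _ (by positivity))

theorem partialKq_strictAnti {q : ℕ} (hq : 2 ≤ q) : StrictAnti (partialKq q) :=
  strictAnti_nat_of_succ_lt (partialKq_succ_lt hq)

theorem partialKq_le_one {q : ℕ} (hq : 2 ≤ q) (k : ℕ) : partialKq q k ≤ 1 := by
  simpa [partialKq] using (partialKq_strictAnti hq).antitone (Nat.zero_le k)

theorem Kq_lt_partialKq {q : ℕ} (hq : 2 ≤ q) (k : ℕ) : Kq q < partialKq q k :=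
  ((partialKq_strictAnti hq).antitone.le_of_tendsto
    (multipliable_Kq q hq).tendsto_prod_tprod_nat (k + 1)).trans_lt (partialKq_succ_lt hq k)

theorem Kq_pos {q : ℕ} (hq : 2 ≤ q) : 0 < Kq q := by
  have hq' : (2 : ℝ) ≤ q := by exact_mod_cast hq
  have h0 : 0 ≤ Kq q := ge_of_tendsto' (multipliable_Kq q hq).tendsto_prod_tprod_nat
    fun k => (partialKq_pos hq k).le
  refine lt_of_le_of_ne h0 (Ne.symm ?_)
  have hs : Summable fun j : ℕ => ‖-((q : ℝ) ^ (j + 1))⁻¹‖ := by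
    have h1 : Summable fun j : ℕ => ((q : ℝ)⁻¹) ^ j :=
      summable_geometric_of_lt_one (by positivity) (inv_lt_one_of_one_lt₀ (by linarith))
    simpa [inv_pow] using (summable_nat_add_iff 1).2 h1
  have h := tprod_one_add_ne_zero_of_summable (f := fun j : ℕ => -((q : ℝ) ^ (j + 1))⁻¹)
    (fun j => by have := inv_pow_succ_lt_one hq j; linarith) hs
  simpa [Kq, sub_eq_add_neg] using h

/-! ### Linear maps and subspaces -/

section Field

variable {K V L : Type*} [Field K] [AddCommGroup V] [Module K V] [AddCommGroup L] [Module K L]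

/-- A linear map factors through any linear map with a smaller kernel. -/
theorem exists_comp_eq_of_ker_le {W : Type*} [AddCommGroup W] [Module K W]
    (A : V →ₗ[K] W) (f : V →ₗ[K] L) (h : LinearMap.ker A ≤ LinearMap.ker f) :
    ∃ B : W →ₗ[K] L, B ∘ₗ A = f := by
  obtain ⟨B, hB⟩ := LinearMap.exists_extend
    ((LinearMap.ker A).liftQ f h ∘ₗ A.quotKerEquivRange.symm.toLinearMap)
  refine ⟨B, LinearMap.ext fun v => ?_⟩
  have h1 := LinearMap.congr_fun hB ⟨A v, LinearMap.mem_range_self A v⟩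
  have h2 : A.quotKerEquivRange.symm ⟨A v, LinearMap.mem_range_self A v⟩
      = Submodule.Quotient.mk v := by
    rw [LinearEquiv.symm_apply_eq]
    rfl
  simpa [h2] using h1

variable [FiniteDimensional K V]

/-- Two linear maps with the same kernel differ by an automorphism of the codomain. -/
theorem exists_linearEquiv_comp_eq_of_ker_eq (g g' : V →ₗ[K] L)
    (h : LinearMap.ker g = LinearMap.ker g') :
    ∃ φ : L ≃ₗ[K] L, φ.toLinearMap ∘ₗ g = g' := by
  obtain ⟨φ, hφ⟩ := Submodule.exists_linearEquiv_restrict_eq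
    (g.quotKerEquivRange.symm ≪≫ₗ Submodule.quotEquivOfEq _ _ h ≪≫ₗ g'.quotKerEquivRange)
  refine ⟨φ, LinearMap.ext fun v => ?_⟩
  have h1 := hφ ⟨g v, LinearMap.mem_range_self g v⟩
  have h2 : g.quotKerEquivRange.symm ⟨g v, LinearMap.mem_range_self g v⟩
      = Submodule.Quotient.mk v := by
    rw [LinearEquiv.symm_apply_eq]
    rfl
  simpa [h2] using h1.symm

theorem exists_submodule_between {T U : Submodule K V} (hTU : T ≤ U) {a : ℕ}
    (h1 : Module.finrank K T ≤ a) (h2 : a ≤ Module.finrank K U) :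
    ∃ R : Submodule K V, T ≤ R ∧ R ≤ U ∧ Module.finrank K R = a := by
  induction a, h1 using Nat.le_induction with
  | base => exact ⟨T, le_rfl, hTU, rfl⟩
  | succ a _ ih =>
    obtain ⟨R, hTR, hRU, hR⟩ := ih (by omega)
    have hlt : R < U := lt_of_le_of_ne hRU (by rintro rfl; omega)
    obtain ⟨v, hvU, hvR⟩ := SetLike.exists_of_lt hlt
    refine ⟨R ⊔ Submodule.span K {v}, hTR.trans le_sup_left,
      sup_le hRU ((Submodule.span_singleton_le_iff_mem _ _).2 hvU), ?_⟩
    rw [Submodule.finrank_sup_span_singleton hvR, hR]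

theorem natCard_linearMap [FiniteDimensional K L] :
    Nat.card (V →ₗ[K] L) = Nat.card K ^ (Module.finrank K V * Module.finrank K L) := by
  rw [Module.natCard_eq_pow_finrank (K := K), Module.finrank_linearMap]

end Field

/-! ### Counting linear maps with a prescribed kernel -/

/-- The number `∏_{i < w} (q^m - q^i)` of injective linear maps from a `w`-dimensional to an
`m`-dimensional space over a field with `q` elements; the formula is meant for `w ≤ m`. -/
def injCount (q m w : ℕ) : ℕ :=
  ∏ i ∈ Finset.range w, (q ^ m - q ^ i)

theorem injCount_succ (q m w : ℕ) : injCount q m (w + 1) = injCount q m w * (q ^ m - q ^ w) :=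
  Finset.prod_range_succ _ _

theorem cast_pow_sub_pow {q m w : ℕ} (hq : 2 ≤ q) (hw : w < m) :
    ((q ^ m - q ^ w : ℕ) : ℝ) = (q : ℝ) ^ m * (1 - ((q : ℝ) ^ (m - w))⁻¹) := by
  have hq0 : (q : ℝ) ≠ 0 := by positivity
  rw [Nat.cast_sub (Nat.pow_le_pow_right (by omega) hw.le), mul_sub, mul_one, ← pow_sub₀ _ hq0
    (Nat.sub_le m w), Nat.sub_sub_self hw.le]
  push_cast
  rfl

theorem injCount_mul_partialKq {q m w : ℕ} (hq : 2 ≤ q) (hw : w ≤ m) :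
    (injCount q m w : ℝ) * partialKq q (m - w) = (q : ℝ) ^ (m * w) * partialKq q m := by
  induction w with
  | zero => simp [injCount]
  | succ w ih =>
    have h := ih (by omega)
    obtain ⟨b, rfl⟩ : ∃ b, m = w + 1 + b := ⟨m - (w + 1), by omega⟩
    rw [show w + 1 + b - w = b + 1 by omega, partialKq_succ] at h
    rw [injCount_succ, Nat.cast_mul, cast_pow_sub_pow hq (by omega),
      show w + 1 + b - (w + 1) = b by omega, show w + 1 + b - w = b + 1 by omega, mul_add, pow_add,
      mul_one]
    linear_combination (q : ℝ) ^ (w + 1 + b) * h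

/-- Each of the last `k` factors of `injCount q m (a + k)` is `q^m (1 - q^{-j})` with a different
`j`, and the `i`-th smallest of these exponents is at least `i`. -/
theorem injCount_mul_le_injCount_add {q m : ℕ} (hq : 2 ≤ q) (a k : ℕ) (h : a + k ≤ m) :
    (injCount q m a : ℝ) * ((q : ℝ) ^ (m * k) * partialKq q k) ≤ injCount q m (a + k) := by
  induction k generalizing a with
  | zero => simp [partialKq]
  | succ k ih =>
    have h1 := ih (a + 1) (by omega)
    rw [show a + (k + 1) = a + 1 + k by omega]
    refine le_trans ?_ h1
    rw [injCount_succ, Nat.cast_mul, cast_pow_sub_pow hq (by omega), partialKq_succ, mul_add,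
      pow_add, mul_one]
    have h2 : ((q : ℝ) ^ (m - a))⁻¹ ≤ ((q : ℝ) ^ (k + 1))⁻¹ := by
      have hq' : (2 : ℝ) ≤ q := by exact_mod_cast hq
      exact inv_anti₀ (by positivity) (pow_le_pow_right₀ (by linarith) (by omega))
    have h3 := (partialKq_pos hq k).le
    calc _ = ((injCount q m a : ℝ) * (q : ℝ) ^ (m * k) * q ^ m * partialKq q k)
            * (1 - ((q : ℝ) ^ (k + 1))⁻¹) := by ring
      _ ≤ ((injCount q m a : ℝ) * (q : ℝ) ^ (m * k) * q ^ m * partialKq q k)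
            * (1 - ((q : ℝ) ^ (m - a))⁻¹) := by gcongr
      _ = _ := by ring

section LinearMaps

variable {K V L : Type*} [Field K] [Finite K] [AddCommGroup V] [Module K V] [Finite V]
  [AddCommGroup L] [Module K L] [Finite L]

/-- The linear maps with kernel `T` are the injective linear maps on the quotient by `T`. -/
theorem natCard_ker_eq (T : Submodule K V) {w : ℕ}
    (hT : Module.finrank K T + w = Module.finrank K V) (hw : w ≤ Module.finrank K L) :
    Nat.card {g : V →ₗ[K] L // LinearMap.ker g = T} =
      injCount (Nat.card K) (Module.finrank K L) w := by
  have := Fintype.ofFinite K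
  have hQ : Module.finrank K (V ⧸ T) = w := by
    have := T.finrank_quotient_add_finrank
    omega
  let b := Module.finBasisOfFinrankEq K (V ⧸ T) hQ
  have e1 : {g : V →ₗ[K] L // LinearMap.ker g = T} ≃
      {h : (V ⧸ T) →ₗ[K] L // LinearMap.ker h = ⊥} :=
    { toFun := fun g => ⟨T.liftQ g.1 g.2.ge, Submodule.ker_liftQ_eq_bot _ _ _ g.2.le⟩
      invFun := fun h => ⟨h.1 ∘ₗ T.mkQ, by rw [LinearMap.ker_comp, h.2, Submodule.comap_bot,
        Submodule.ker_mkQ]⟩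
      left_inv := fun g => by ext; simp
      right_inv := fun h => by ext; simp }
  have e2 : {h : (V ⧸ T) →ₗ[K] L // LinearMap.ker h = ⊥} ≃
      {s : Fin w → L // LinearIndependent K s} :=
    (b.constr K).symm.toEquiv.subtypeEquiv fun h => by
      have : ((b.constr K).symm.toEquiv h) = h ∘ b := rfl
      rw [this]
      refine ⟨fun hh => b.linearIndependent.map' h hh, fun hh => ?_⟩
      refine LinearMap.ker_eq_bot'.2 fun x hx => ?_
      have h0 := Fintype.linearIndependent_iff.1 hh (b.repr x) (by
        simp only [Function.comp_apply, ← map_smul, ← map_sum, b.sum_repr, hx])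
      exact b.repr.map_eq_zero_iff.1 (Finsupp.ext h0)
  rw [Nat.card_congr (e1.trans e2), card_linearIndependent hw, injCount, Nat.card_eq_fintype_card,
    Finset.prod_range]

/-- The number of linear maps of rank at most `t`, i.e. the volume of a ball of radius `t` in the
rank metric. -/
noncomputable def ballCard (K V L : Type*) [Field K] [AddCommGroup V] [Module K V]
    [AddCommGroup L] [Module K L] (t : ℕ) : ℕ :=
  Nat.card {f : V →ₗ[K] L // Module.finrank K (LinearMap.range f) ≤ t}

/-- Every map of rank at most `t` factors through `K^t`, and it does so through at least
`injCount q t t` different maps `V → K^t`. -/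
theorem ballCard_mul_injCount_le {t : ℕ} (ht : t ≤ Module.finrank K V) :
    ballCard K V L t * injCount (Nat.card K) t t ≤
      Nat.card K ^ (t * (Module.finrank K L + Module.finrank K V)) := by
  classical
  have : Finite (V →ₗ[K] L) := Module.finite_of_finite K
  have := Fintype.ofFinite {f : V →ₗ[K] L // Module.finrank K (LinearMap.range f) ≤ t}
  have : Finite (V →ₗ[K] (Fin t → K)) := Module.finite_of_finite K
  have : Finite ((Fin t → K) →ₗ[K] L) := Module.finite_of_finite K
  have hlow : ballCard K V L t * injCount (Nat.card K) t t ≤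
      Nat.card (Σ f : {f : V →ₗ[K] L // Module.finrank K (LinearMap.range f) ≤ t},
        {A : V →ₗ[K] (Fin t → K) // LinearMap.ker A ≤ LinearMap.ker f.1}) := by
    rw [Nat.card_sigma, ballCard, Nat.card_eq_fintype_card, ← smul_eq_mul]
    refine Finset.card_nsmul_le_sum _ _ _ fun f _ => ?_
    have h1 := f.1.finrank_range_add_finrank_ker
    obtain ⟨T, -, hT, hT'⟩ := exists_submodule_between (bot_le : ⊥ ≤ LinearMap.ker f.1)
      (a := Module.finrank K V - t) (by simp) (by have := f.2; omega)
    have h2 := natCard_ker_eq (L := Fin t → K) T (w := t) (by omega) (by simp)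
    rw [Module.finrank_fin_fun] at h2
    rw [← h2]
    exact Nat.card_le_card_of_injective (fun A => ⟨A.1, A.2.le.trans hT⟩)
      fun A B hAB => Subtype.ext (congrArg (fun z => z.1) hAB)
  refine hlow.trans ?_
  have hB := fun p : (Σ f : {f : V →ₗ[K] L // Module.finrank K (LinearMap.range f) ≤ t},
      {A : V →ₗ[K] (Fin t → K) // LinearMap.ker A ≤ LinearMap.ker f.1}) =>
    exists_comp_eq_of_ker_le p.2.1 p.1.1 p.2.2
  choose B hB using hB
  have h3 := Nat.card_le_card_of_injective
    (fun p => ((p.2.1, B p) : (V →ₗ[K] (Fin t → K)) × ((Fin t → K) →ₗ[K] L))) (by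
      rintro ⟨⟨f, hf⟩, ⟨A, hA⟩⟩ ⟨⟨f', hf'⟩, ⟨A', hA'⟩⟩ h
      have h1 := hB ⟨⟨f, hf⟩, ⟨A, hA⟩⟩
      have h2 := hB ⟨⟨f', hf'⟩, ⟨A', hA'⟩⟩
      rw [Prod.mk.injEq] at h
      obtain ⟨hAA, hBB⟩ := h
      dsimp only at hAA h1 h2
      subst hAA
      rw [hBB, h2] at h1
      subst h1
      rfl)
  refine h3.trans_eq ?_
  rw [Nat.card_prod, natCard_linearMap, natCard_linearMap, Module.finrank_fin_fun, ← pow_add]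
  congr 1
  ring

theorem ballCard_le {t : ℕ} (hq : 2 ≤ Nat.card K) (ht : t ≤ Module.finrank K V) :
    (ballCard K V L t : ℝ) * ((Nat.card K : ℝ) ^ (t * t) * partialKq (Nat.card K) t) ≤
      (Nat.card K : ℝ) ^ (t * (Module.finrank K L + Module.finrank K V)) := by
  have h := injCount_mul_partialKq hq (le_refl t)
  rw [← h, Nat.sub_self, show partialKq (Nat.card K) 0 = 1 by simp [partialKq], mul_one]
  exact_mod_cast ballCard_mul_injCount_le (K := K) (V := V) (L := L) ht

end LinearMaps

/-! ### Decodable maps with a prescribed kernel -/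

section Field

variable {K V L : Type*} [Field K] [AddCommGroup V] [Module K V] [FiniteDimensional K V]
  [AddCommGroup L] [Module K L]

/-- In a set of linear maps with minimum rank distance `d`, a map is determined by its restriction
to any subspace of dimension larger than `dim V - d`. -/
theorem eq_of_le_ker_sub {X : Set (V →ₗ[K] L)} {d : ℕ}
    (hX : ∀ x ∈ X, ∀ y ∈ X, x ≠ y → d ≤ Module.finrank K (LinearMap.range (x - y)))
    {x y : V →ₗ[K] L} (hx : x ∈ X) (hy : y ∈ X) {U : Submodule K V}
    (hU : U ≤ LinearMap.ker (x - y)) (hd : Module.finrank K V < Module.finrank K U + d) :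
    x = y := by
  by_contra hne
  have h1 := hX x hx y hy hne
  have h2 := (x - y).finrank_range_add_finrank_ker
  have h3 := Submodule.finrank_mono hU
  omega

end Field

section Decodable

variable {K V L : Type*} [Field K] [Finite K] [AddCommGroup V] [Module K V] [Finite V]
  [AddCommGroup L] [Module K L] [Finite L]

open scoped Classical in
/-- The number of maps of rank at most `t` restricting to a given `g` on `S` depends on `ker g`
only, because the automorphisms of `L` act transitively on the maps with a given kernel. Hence a
set of maps on `S` that has density at most `1 / ρ` among the maps with kernel `T`, for every `T`,
has a preimage of density at most `1 / ρ` in the ball of radius `t`. -/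
theorem natCard_domRestrict_mem_mul_le (S : Submodule K V) (Y : Set (S →ₗ[K] L)) (t : ℕ) (ρ : ℝ)
    (hY : ∀ T : Submodule K S, (Nat.card {g : S →ₗ[K] L // g ∈ Y ∧ LinearMap.ker g = T} : ℝ) * ρ ≤
      Nat.card {g : S →ₗ[K] L // LinearMap.ker g = T}) :
    (Nat.card {f : V →ₗ[K] L // Module.finrank K (LinearMap.range f) ≤ t ∧
      f.domRestrict S ∈ Y} : ℝ) * ρ ≤ ballCard K V L t := by
  have : Finite (V →ₗ[K] L) := Module.finite_of_finite K
  have : Finite (S →ₗ[K] L) := Module.finite_of_finite K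
  have := Fintype.ofFinite (V →ₗ[K] L)
  have := Fintype.ofFinite (S →ₗ[K] L)
  have := Fintype.ofFinite (Submodule K S)
  have hF : ∀ g g' : S →ₗ[K] L, LinearMap.ker g = LinearMap.ker g' →
      (Finset.univ.filter fun f : V →ₗ[K] L =>
        Module.finrank K (LinearMap.range f) ≤ t ∧ f.domRestrict S = g).card =
      (Finset.univ.filter fun f : V →ₗ[K] L =>
        Module.finrank K (LinearMap.range f) ≤ t ∧ f.domRestrict S = g').card := by
    intro g g' h
    obtain ⟨φ, rfl⟩ := exists_linearEquiv_comp_eq_of_ker_eq g g' h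
    refine Finset.card_equiv (LinearEquiv.congrRight φ).toEquiv fun f => ?_
    have h1 : (LinearEquiv.congrRight φ).toEquiv f = φ.toLinearMap ∘ₗ f := rfl
    have h2 : (φ.toLinearMap ∘ₗ f).domRestrict S = φ.toLinearMap ∘ₗ f.domRestrict S := rfl
    rw [h1, Finset.mem_filter, Finset.mem_filter, h2, LinearMap.range_comp,
      LinearEquiv.finrank_map_eq]
    have h3 : φ.toLinearMap ∘ₗ f.domRestrict S = φ.toLinearMap ∘ₗ g ↔ f.domRestrict S = g :=
      ⟨fun hh => LinearMap.ext fun v => φ.injective (LinearMap.congr_fun hh v), fun hh => by rw [hh]⟩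
    simp [h3]
  have key : ∀ (Z : Set (S →ₗ[K] L)) (T : Submodule K S) (c : ℕ),
      (∀ g : S →ₗ[K] L, LinearMap.ker g = T → (Finset.univ.filter fun f : V →ₗ[K] L =>
        Module.finrank K (LinearMap.range f) ≤ t ∧ f.domRestrict S = g).card = c) →
      (Finset.univ.filter fun f : V →ₗ[K] L => (Module.finrank K (LinearMap.range f) ≤ t ∧
        f.domRestrict S ∈ Z) ∧ LinearMap.ker (f.domRestrict S) = T).card =
      Nat.card {g : S →ₗ[K] L // g ∈ Z ∧ LinearMap.ker g = T} * c := by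
    intro Z T c hc
    rw [Finset.card_eq_sum_card_fiberwise (f := fun f : V →ₗ[K] L => f.domRestrict S)
      (t := Finset.univ.filter fun g : S →ₗ[K] L => g ∈ Z ∧ LinearMap.ker g = T)
      (fun f hf => by
        simp only [Finset.coe_filter, Finset.mem_univ, true_and, Set.mem_ofPred_eq] at hf ⊢
        exact ⟨hf.1.2, hf.2⟩)]
    rw [Nat.card_eq_fintype_card, Fintype.card_subtype, ← smul_eq_mul, ← Finset.sum_const]
    refine Finset.sum_congr rfl fun g hg => ?_
    rw [Finset.mem_filter] at hg
    rw [← hc g hg.2.2, Finset.filter_filter]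
    congr 1
    ext f
    simp only [Finset.mem_filter, Finset.mem_univ, true_and]
    constructor
    · rintro ⟨⟨⟨h1, -⟩, -⟩, h2⟩
      exact ⟨h1, h2⟩
    · rintro ⟨h1, rfl⟩
      exact ⟨⟨⟨h1, hg.2.1⟩, hg.2.2⟩, rfl⟩
  have hball : ballCard K V L t = Nat.card {f : V →ₗ[K] L //
      Module.finrank K (LinearMap.range f) ≤ t ∧ f.domRestrict S ∈ Set.univ} := by
    simp [ballCard]
  rw [hball, Nat.card_eq_fintype_card, Nat.card_eq_fintype_card, Fintype.card_subtype,
    Fintype.card_subtype,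
    Finset.card_eq_sum_card_fiberwise (f := fun f : V →ₗ[K] L => LinearMap.ker (f.domRestrict S))
      (t := Finset.univ) (fun _ _ => by simp),
    Finset.card_eq_sum_card_fiberwise (f := fun f : V →ₗ[K] L => LinearMap.ker (f.domRestrict S))
      (s := Finset.univ.filter fun f : V →ₗ[K] L => Module.finrank K (LinearMap.range f) ≤ t ∧
        f.domRestrict S ∈ Set.univ) (t := Finset.univ) (fun _ _ => by simp)]
  push_cast
  rw [Finset.sum_mul]
  refine Finset.sum_le_sum fun T _ => ?_
  obtain ⟨c, hc⟩ : ∃ c : ℕ, ∀ g : S →ₗ[K] L, LinearMap.ker g = T →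
      (Finset.univ.filter fun f : V →ₗ[K] L =>
        Module.finrank K (LinearMap.range f) ≤ t ∧ f.domRestrict S = g).card = c := by
    by_cases hT : ∃ g : S →ₗ[K] L, LinearMap.ker g = T
    · obtain ⟨g, hg⟩ := hT
      exact ⟨_, fun g' hg' => hF g' g (hg'.trans hg.symm)⟩
    · exact ⟨0, fun g hg => absurd ⟨g, hg⟩ hT⟩
  rw [Finset.filter_filter, Finset.filter_filter, key Y T c hc]
  calc _ = (Nat.card {g : S →ₗ[K] L // g ∈ Y ∧ LinearMap.ker g = T} : ℝ) * ρ * c := by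
        push_cast
        ring
    _ ≤ Nat.card {g : S →ₗ[K] L // LinearMap.ker g = T} * (c : ℝ) :=
        mul_le_mul_of_nonneg_right (hY T) (Nat.cast_nonneg c)
    _ = ((Nat.card {g : S →ₗ[K] L // g ∈ Set.univ ∧ LinearMap.ker g = T} * c : ℕ) : ℝ) := by
        simp only [Set.mem_univ, true_and, Nat.cast_mul]
    _ = _ := by
        rw [← key Set.univ T c hc]
        congr!

/-- The decodable maps with kernel `S` for the code `X` with decoding radius `t`. -/
abbrev DecodableWithKer (X : Set (V →ₗ[K] L)) (t : ℕ) (S : Submodule K V) : Type _ :=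
  {e : V →ₗ[K] L // LinearMap.ker e = S ∧ ∃ x ∈ X, Module.finrank K (LinearMap.range (x - e)) ≤ t}

/-- If `e` vanishes on `S` and `x - e = f`, then `x` and `f` agree on `S`, and `f` has at most
`q^{m(u+1-d)}` such companions `x` in the code. -/
theorem natCard_decodableWithKer_le_mul {X : Set (V →ₗ[K] L)} {d t u : ℕ}
    (hX : ∀ x ∈ X, ∀ y ∈ X, x ≠ y → d ≤ Module.finrank K (LinearMap.range (x - y)))
    (S : Submodule K V) (hS : Module.finrank K S + u = Module.finrank K V)
    (hd : 1 ≤ d) (hdu : d ≤ u + 1) :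
    Nat.card (DecodableWithKer X t S) ≤
      ballCard K V L t * Nat.card K ^ (Module.finrank K L * (u + 1 - d)) := by
  have : Finite (V →ₗ[K] L) := Module.finite_of_finite K
  have := Fintype.ofFinite {f : V →ₗ[K] L // Module.finrank K (LinearMap.range f) ≤ t}
  -- A complement of `S` in a subspace of dimension `dim V - d + 1`.
  obtain ⟨R, hSR, hR⟩ : ∃ R : Submodule K V,
      S ⊓ R = ⊥ ∧ Module.finrank K R = u + 1 - d := by
    obtain ⟨R₀, hR₀⟩ := Submodule.exists_isCompl S
    have h1 := Submodule.finrank_add_eq_of_isCompl hR₀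
    obtain ⟨R, -, hR, hR'⟩ := exists_submodule_between (bot_le : ⊥ ≤ R₀) (a := u + 1 - d)
      (by simp) (by omega)
    exact ⟨R, le_bot_iff.1 ((inf_le_inf_left S hR).trans hR₀.inf_eq_bot.le), hR'⟩
  have hdim : Module.finrank K V < Module.finrank K (S ⊔ R : Submodule K V) + d := by
    have h1 := Submodule.finrank_sup_add_finrank_inf_eq S R
    rw [hSR, finrank_bot] at h1
    omega
  have hfib : ∀ f : V →ₗ[K] L, Nat.card {x // x ∈ X ∧ x.domRestrict S = f.domRestrict S} ≤
      Nat.card K ^ (Module.finrank K L * (u + 1 - d)) := by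
    intro f
    have : Finite (R →ₗ[K] L) := Module.finite_of_finite K
    rw [← hR, mul_comm, ← natCard_linearMap]
    refine Nat.card_le_card_of_injective (fun x => x.1.domRestrict R) fun x y hxy => ?_
    refine Subtype.ext (eq_of_le_ker_sub hX x.2.1 y.2.1 (sup_le ?_ ?_) hdim)
    · intro v hv
      have := LinearMap.congr_fun (x.2.2.trans y.2.2.symm) ⟨v, hv⟩
      simpa [sub_eq_zero] using this
    · intro v hv
      have := LinearMap.congr_fun hxy ⟨v, hv⟩
      simpa [sub_eq_zero] using this
  calc Nat.card (DecodableWithKer X t S)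
      ≤ Nat.card (Σ f : {f : V →ₗ[K] L // Module.finrank K (LinearMap.range f) ≤ t},
          {x // x ∈ X ∧ x.domRestrict S = f.1.domRestrict S}) := by
        choose x hx hxt using fun e : DecodableWithKer X t S => e.2.2
        refine Nat.card_le_card_of_injective (fun e => ⟨⟨x e - e.1, hxt e⟩, ⟨x e, hx e, ?_⟩⟩)
          fun e e' hee => ?_
        · ext ⟨v, hv⟩
          have : v ∈ LinearMap.ker e.1 := e.2.1.ge hv
          simp [LinearMap.mem_ker.1 this]
        · have h1 : x e - e.1 = x e' - e'.1 := congrArg (fun p => p.1.1) hee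
          have h2 : x e = x e' := congrArg (fun p => p.2.1) hee
          rw [h2] at h1
          exact Subtype.ext (sub_right_injective h1)
    _ ≤ _ := by
        rw [Nat.card_sigma, ballCard, Nat.card_eq_fintype_card, ← smul_eq_mul]
        exact Finset.sum_le_card_nsmul _ _ _ fun f _ => hfib f.1

/-- The codewords that restrict to maps with kernel `T` on `S` are determined by their restriction
to a subspace of dimension `dim V - d + 1` between `T` and `S`, where their kernel is still `T`. -/
theorem natCard_domRestrict_ker_mul_le {X : Set (V →ₗ[K] L)} {d u k : ℕ} (hq : 2 ≤ Nat.card K)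
    (hX : ∀ x ∈ X, ∀ y ∈ X, x ≠ y → d ≤ Module.finrank K (LinearMap.range (x - y)))
    (hX0 : ∀ x ∈ X, d ≤ Module.finrank K (LinearMap.range x))
    (S : Submodule K V) (hS : Module.finrank K S + u = Module.finrank K V) (hd : d = u + k + 1)
    (T : Submodule K S) :
    (Nat.card {g : S →ₗ[K] L // g ∈ (fun x : V →ₗ[K] L => x.domRestrict S) '' X ∧
        LinearMap.ker g = T} : ℝ) *
      ((Nat.card K : ℝ) ^ (Module.finrank K L * k) * partialKq (Nat.card K) k) ≤
      Nat.card {g : S →ₗ[K] L // LinearMap.ker g = T} := by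
  rcases isEmpty_or_nonempty {g : S →ₗ[K] L //
    g ∈ (fun x : V →ₗ[K] L => x.domRestrict S) '' X ∧ LinearMap.ker g = T} with
    hE | ⟨g, ⟨x, hx, hxg⟩, hg⟩
  · rw [Nat.card_of_isEmpty, Nat.cast_zero, zero_mul]
    exact Nat.cast_nonneg _
  have hmap : ∀ U : Submodule K S, Module.finrank K (U.map S.subtype) = Module.finrank K U :=
    fun U => (S.equivSubtypeMap U).finrank_eq.symm
  -- A nonzero codeword has a small kernel, so `T` has codimension larger than `k` in `S`.
  have hT : Module.finrank K T + k + 1 ≤ Module.finrank K S := by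
    have h1 : T.map S.subtype ≤ LinearMap.ker x := by
      rintro _ ⟨v, hv, rfl⟩
      rw [SetLike.mem_coe, ← hg, ← hxg] at hv
      exact hv
    have h2 := Submodule.finrank_mono h1
    have h3 := x.finrank_range_add_finrank_ker
    have h4 := hX0 x hx
    rw [hmap] at h2
    omega
  obtain ⟨a, ha⟩ : ∃ a, Module.finrank K T + (a + k) = Module.finrank K S :=
    ⟨Module.finrank K S - Module.finrank K T - k, by omega⟩
  have hm : a + k ≤ Module.finrank K L := by
    have h1 := g.finrank_range_add_finrank_ker
    have h2 := (LinearMap.range g).finrank_le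
    rw [hg] at h1
    omega
  obtain ⟨R, hTR, -, hR⟩ := exists_submodule_between (le_top : T ≤ ⊤)
    (a := Module.finrank K T + a) (by omega) (by rw [finrank_top]; omega)
  have hTR' : Module.finrank K (T.comap R.subtype) = Module.finrank K T :=
    (Submodule.comapSubtypeEquivOfLe hTR).finrank_eq
  rw [natCard_ker_eq T ha hm]
  refine le_trans ?_ (injCount_mul_le_injCount_add hq a k hm)
  rw [← natCard_ker_eq (L := L) (T.comap R.subtype) (w := a) (by omega) (by omega)]
  have hpos := partialKq_pos hq k
  refine mul_le_mul_of_nonneg_right ?_ (by positivity)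
  have : Finite (R →ₗ[K] L) := Module.finite_of_finite K
  refine Nat.cast_le.2 (Nat.card_le_card_of_injective
    (fun g => ⟨g.1.domRestrict R, by
      rw [LinearMap.domRestrict, LinearMap.ker_comp, g.2.2]⟩) ?_)
  rintro ⟨_, ⟨x, hx, rfl⟩, hxT⟩ ⟨_, ⟨y, hy, rfl⟩, hyT⟩ hxy
  have hxy' : (x.domRestrict S).domRestrict R = (y.domRestrict S).domRestrict R :=
    congrArg (fun z => z.1) hxy
  obtain rfl := eq_of_le_ker_sub hX hx hy (U := R.map S.subtype) (by
    rintro _ ⟨v, hv, rfl⟩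
    have := LinearMap.congr_fun hxy' ⟨v, hv⟩
    simpa [sub_eq_zero] using this) (by rw [hmap]; omega)
  rfl

/-- If `d = dim V - dim S + k + 1`, the decodable maps with kernel `S` correspond injectively to maps
in the ball of radius `t` that agree on `S` with a codeword. -/
theorem natCard_decodableWithKer_mul_le {X : Set (V →ₗ[K] L)} {d t u k : ℕ} (hq : 2 ≤ Nat.card K)
    (hX : ∀ x ∈ X, ∀ y ∈ X, x ≠ y → d ≤ Module.finrank K (LinearMap.range (x - y)))
    (hX0 : ∀ x ∈ X, d ≤ Module.finrank K (LinearMap.range x))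
    (S : Submodule K V) (hS : Module.finrank K S + u = Module.finrank K V) (hd : d = u + k + 1) :
    (Nat.card (DecodableWithKer X t S) : ℝ) *
      ((Nat.card K : ℝ) ^ (Module.finrank K L * k) * partialKq (Nat.card K) k) ≤
      ballCard K V L t := by
  refine le_trans ?_ (natCard_domRestrict_mem_mul_le S
    ((fun x : V →ₗ[K] L => x.domRestrict S) '' X) t _
    (natCard_domRestrict_ker_mul_le hq hX hX0 S hS hd))
  have hpos := partialKq_pos hq k
  refine mul_le_mul_of_nonneg_right (Nat.cast_le.2 ?_) (by positivity)
  have : Finite (V →ₗ[K] L) := Module.finite_of_finite K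
  choose x hx hxt using fun e : DecodableWithKer X t S => e.2.2
  have hres : ∀ e : DecodableWithKer X t S, (x e).domRestrict S = (x e - e.1).domRestrict S := by
    intro e
    ext ⟨v, hv⟩
    have : v ∈ LinearMap.ker e.1 := e.2.1.ge hv
    simp [LinearMap.mem_ker.1 this]
  refine Nat.card_le_card_of_injective
    (fun e => ⟨x e - e.1, hxt e, x e, hx e, hres e⟩) fun e e' hee => ?_
  have h1 : x e - e.1 = x e' - e'.1 := congrArg (fun p => p.1) hee
  have h2 : x e = x e' := by
    refine eq_of_le_ker_sub hX (hx e) (hx e') (U := S) (fun v hv => ?_) (by omega)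
    have := LinearMap.congr_fun ((hres e).trans
      ((congrArg (fun z => z.domRestrict S) h1).trans (hres e').symm)) ⟨v, hv⟩
    simpa [sub_eq_zero] using this
  rw [h2] at h1
  exact Subtype.ext (sub_right_injective h1)

/-- The proportion of decodable maps among the maps with kernel `S` is at most
`V_t q^{-m(d-1)} / ∏_{j ≤ m} (1 - q^{-j})`, where `V_t` is the volume of a ball of radius `t`. -/
theorem natCard_decodableWithKer_mul_le_injCount {X : Set (V →ₗ[K] L)} {d t u : ℕ}
    (hq : 2 ≤ Nat.card K)
    (hX : ∀ x ∈ X, ∀ y ∈ X, x ≠ y → d ≤ Module.finrank K (LinearMap.range (x - y)))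
    (hX0 : ∀ x ∈ X, d ≤ Module.finrank K (LinearMap.range x))
    (S : Submodule K V) (hS : Module.finrank K S + u = Module.finrank K V)
    (hd : 1 ≤ d) (hdm : d ≤ Module.finrank K L) (hu : u ≤ Module.finrank K L) :
    (Nat.card (DecodableWithKer X t S) : ℝ) * ((Nat.card K : ℝ) ^ (Module.finrank K L * (d - 1)) *
      partialKq (Nat.card K) (Module.finrank K L)) ≤
      ballCard K V L t * injCount (Nat.card K) (Module.finrank K L) u := by
  set q := Nat.card K
  set m := Module.finrank K L
  set D := Nat.card (DecodableWithKer X t S)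
  have hq0 : (0 : ℝ) < q := by exact_mod_cast (by omega : 0 < q)
  have hα := injCount_mul_partialKq hq hu
  have hα0 : (0 : ℝ) ≤ injCount q m u := Nat.cast_nonneg _
  have hB : (0 : ℝ) ≤ ballCard K V L t := Nat.cast_nonneg _
  have hmu := (partialKq_pos hq (m - u)).le
  rcases le_or_gt d (u + 1) with h | h
  · have h1 : (D : ℝ) ≤ ballCard K V L t * (q : ℝ) ^ (m * (u + 1 - d)) := by
      exact_mod_cast natCard_decodableWithKer_le_mul hX S hS hd h
    calc (D : ℝ) * ((q : ℝ) ^ (m * (d - 1)) * partialKq q m)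
        ≤ ballCard K V L t * (q : ℝ) ^ (m * (u + 1 - d)) *
            ((q : ℝ) ^ (m * (d - 1)) * partialKq q m) := by
          have := (partialKq_pos hq m).le
          gcongr
      _ = ballCard K V L t * ((q : ℝ) ^ (m * u) * partialKq q m) := by
          rw [show m * u = m * (u + 1 - d) + m * (d - 1) by
            rw [← mul_add]; congr 1; omega, pow_add]
          ring
      _ = ballCard K V L t * (injCount q m u * partialKq q (m - u)) := by rw [hα]
      _ ≤ ballCard K V L t * injCount q m u := by
          gcongr
          exact mul_le_of_le_one_right hα0 (partialKq_le_one hq _)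
  · obtain ⟨k, hk⟩ : ∃ k, d = u + k + 1 := ⟨d - 1 - u, by omega⟩
    have h1 := natCard_decodableWithKer_mul_le (t := t) hq hX hX0 S hS hk
    calc (D : ℝ) * ((q : ℝ) ^ (m * (d - 1)) * partialKq q m)
        = (D : ℝ) * (q : ℝ) ^ (m * k) * ((q : ℝ) ^ (m * u) * partialKq q m) := by
          rw [show m * (d - 1) = m * k + m * u by rw [← mul_add]; congr 1; omega, pow_add]
          ring
      _ = (D : ℝ) * (q : ℝ) ^ (m * k) * (injCount q m u * partialKq q (m - u)) := by rw [hα]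
      _ ≤ (D : ℝ) * (q : ℝ) ^ (m * k) * (injCount q m u * partialKq q k) := by
          gcongr
          exact (partialKq_strictAnti hq).antitone (by omega)
      _ = (D : ℝ) * ((q : ℝ) ^ (m * k) * partialKq q k) * injCount q m u := by ring
      _ ≤ ballCard K V L t * injCount q m u := by gcongr

end Decodable

/-! ### The proportion of decodable maps of a given rank -/

section Proportion

variable {K V L : Type*} [Field K] [Finite K] [AddCommGroup V] [Module K V] [Finite V]
  [AddCommGroup L] [Module K L] [Finite L]

/-- The bound of `natCard_decodableWithKer_mul_le_injCount`, summed over all possible kernels. -/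
theorem natCard_decodable_mul_le {X : Set (V →ₗ[K] L)} {d t u : ℕ} (hq : 2 ≤ Nat.card K)
    (hX : ∀ x ∈ X, ∀ y ∈ X, x ≠ y → d ≤ Module.finrank K (LinearMap.range (x - y)))
    (hX0 : ∀ x ∈ X, d ≤ Module.finrank K (LinearMap.range x))
    (hd : 1 ≤ d) (hdm : d ≤ Module.finrank K L) (hu : u ≤ Module.finrank K L) :
    (Nat.card {e : V →ₗ[K] L // Module.finrank K (LinearMap.range e) = u ∧
        ∃ x ∈ X, Module.finrank K (LinearMap.range (x - e)) ≤ t} : ℝ) *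
      ((Nat.card K : ℝ) ^ (Module.finrank K L * (d - 1)) *
        partialKq (Nat.card K) (Module.finrank K L)) ≤
      ballCard K V L t *
        Nat.card {e : V →ₗ[K] L // Module.finrank K (LinearMap.range e) = u} := by
  have : Finite (V →ₗ[K] L) := Module.finite_of_finite K
  have := Fintype.ofFinite {S : Submodule K V // Module.finrank K S + u = Module.finrank K V}
  have h1 : Nat.card {e : V →ₗ[K] L // Module.finrank K (LinearMap.range e) = u ∧
        ∃ x ∈ X, Module.finrank K (LinearMap.range (x - e)) ≤ t} ≤
      Nat.card (Σ S : {S : Submodule K V // Module.finrank K S + u = Module.finrank K V},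
        DecodableWithKer X t S.1) := by
    refine Nat.card_le_card_of_injective (fun e => ⟨⟨LinearMap.ker e.1, by
      have h := e.1.finrank_range_add_finrank_ker
      have := e.2.1
      omega⟩, ⟨e.1, rfl, e.2.2⟩⟩)
      fun e e' h => Subtype.ext (congrArg (fun p => p.2.1) h)
  have h2 : Nat.card (Σ S : {S : Submodule K V // Module.finrank K S + u = Module.finrank K V},
        {e : V →ₗ[K] L // LinearMap.ker e = S.1}) ≤
      Nat.card {e : V →ₗ[K] L // Module.finrank K (LinearMap.range e) = u} := by
    refine Nat.card_le_card_of_injective (fun p => ⟨p.2.1, by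
      have h := p.2.1.finrank_range_add_finrank_ker
      rw [p.2.2] at h
      have := p.1.2
      omega⟩) ?_
    rintro ⟨⟨S, hS⟩, ⟨e, he⟩⟩ ⟨⟨S', hS'⟩, ⟨e', he'⟩⟩ h
    obtain rfl : e = e' := congrArg (fun z => z.1) h
    dsimp only at he he'
    subst he he'
    rfl
  rw [Nat.card_sigma] at h1 h2
  have hpos := (partialKq_pos hq (Module.finrank K L)).le
  refine (mul_le_mul_of_nonneg_right (Nat.cast_le.2 h1) (by positivity)).trans ?_
  refine le_trans ?_ (mul_le_mul_of_nonneg_left (Nat.cast_le.2 h2) (Nat.cast_nonneg _))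
  rw [Nat.cast_sum, Nat.cast_sum, Finset.sum_mul, Finset.mul_sum]
  refine Finset.sum_le_sum fun S _ => ?_
  rw [natCard_ker_eq S.1 S.2 hu]
  exact natCard_decodableWithKer_mul_le_injCount hq hX hX0 S.1 S.2 hd hdm hu

/-- The bound `q^{-t^2} / K_q^2` on the proportion of decodable maps among the maps of rank `u`. -/
theorem natCard_decodable_div_lt {X : Set (V →ₗ[K] L)} {d t u : ℕ} (hq : 2 ≤ Nat.card K)
    (hX : ∀ x ∈ X, ∀ y ∈ X, x ≠ y → d ≤ Module.finrank K (LinearMap.range (x - y)))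
    (hX0 : ∀ x ∈ X, d ≤ Module.finrank K (LinearMap.range x))
    (htd : 2 * t + 1 ≤ d) (hdV : d ≤ Module.finrank K V)
    (hVL : Module.finrank K V ≤ Module.finrank K L) (hu : u ≤ Module.finrank K V)
    (hne : Nonempty {e : V →ₗ[K] L // Module.finrank K (LinearMap.range e) = u}) :
    (Nat.card {e : V →ₗ[K] L // Module.finrank K (LinearMap.range e) = u ∧
        ∃ x ∈ X, Module.finrank K (LinearMap.range (x - e)) ≤ t} : ℝ) /
      Nat.card {e : V →ₗ[K] L // Module.finrank K (LinearMap.range e) = u} <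
      (Nat.card K : ℝ) ^ (-((t : ℤ) ^ 2)) / Kq (Nat.card K) ^ 2 := by
  have : Finite (V →ₗ[K] L) := Module.finite_of_finite K
  have h1 := natCard_decodable_mul_le (t := t) (u := u) hq hX hX0 (by omega) (by omega) (by omega)
  have h2 := ballCard_le (K := K) (V := V) (L := L) (t := t) hq (by omega)
  have hA : (0 : ℝ) < Nat.card {e : V →ₗ[K] L // Module.finrank K (LinearMap.range e) = u} :=
    Nat.cast_pos.2 Nat.card_pos
  generalize (Nat.card {e : V →ₗ[K] L // Module.finrank K (LinearMap.range e) = u} : ℝ) = A at *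
  have hB0 : (0 : ℝ) ≤ Nat.card {e : V →ₗ[K] L // Module.finrank K (LinearMap.range e) = u ∧
        ∃ x ∈ X, Module.finrank K (LinearMap.range (x - e)) ≤ t} := Nat.cast_nonneg _
  generalize (Nat.card {e : V →ₗ[K] L // Module.finrank K (LinearMap.range e) = u ∧
        ∃ x ∈ X, Module.finrank K (LinearMap.range (x - e)) ≤ t} : ℝ) = B at *
  generalize Nat.card K = q at *
  generalize Module.finrank K L = m at *
  generalize Module.finrank K V = n at *
  have hq1 : (1 : ℝ) ≤ q := by exact_mod_cast (by omega : 1 ≤ q)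
  have hq0 : (0 : ℝ) < q := by linarith
  have hpm := partialKq_pos hq m
  have hpt := partialKq_pos hq t
  have hexp : t * (m + n) ≤ m * (d - 1) := by
    calc t * (m + n) ≤ t * (m + m) := by gcongr
      _ = m * (2 * t) := by ring
      _ ≤ m * (d - 1) := Nat.mul_le_mul_left _ (by omega)
  have h3 : B * ((q : ℝ) ^ (t * t) * (partialKq q m * partialKq q t)) ≤ A := by
    refine le_of_mul_le_mul_left ?_ (pow_pos hq0 (m * (d - 1)))
    calc (q : ℝ) ^ (m * (d - 1)) * (B * ((q : ℝ) ^ (t * t) * (partialKq q m * partialKq q t)))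
        = B * ((q : ℝ) ^ (m * (d - 1)) * partialKq q m) * ((q : ℝ) ^ (t * t) * partialKq q t) := by
          ring
      _ ≤ ballCard K V L t * A * ((q : ℝ) ^ (t * t) * partialKq q t) := by gcongr
      _ = ballCard K V L t * ((q : ℝ) ^ (t * t) * partialKq q t) * A := by ring
      _ ≤ (q : ℝ) ^ (t * (m + n)) * A := by gcongr
      _ ≤ (q : ℝ) ^ (m * (d - 1)) * A := by gcongr
  have hK := Kq_pos hq
  have h4 : Kq q ^ 2 < partialKq q m * partialKq q t := by
    rw [pow_two]
    exact mul_lt_mul (Kq_lt_partialKq hq m) (Kq_lt_partialKq hq t).le hK hpm.le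
  have h5 : (q : ℝ) ^ (-((t : ℤ) ^ 2)) = ((q : ℝ) ^ (t * t))⁻¹ := by
    rw [zpow_neg, pow_two]
    norm_cast
  rw [h5, div_lt_div_iff₀ hA (by positivity), inv_mul_eq_div, lt_div_iff₀ (by positivity)]
  rcases hB0.eq_or_lt with h | h
  · simpa [← h] using hA
  · calc B * Kq q ^ 2 * (q : ℝ) ^ (t * t)
        < B * (partialKq q m * partialKq q t) * (q : ℝ) ^ (t * t) := by
          gcongr
      _ = B * ((q : ℝ) ^ (t * t) * (partialKq q m * partialKq q t)) := by ring
      _ ≤ A := h3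

end Proportion

/-! ### Vectors as linear maps, and the decoder error probability -/

section Vectors

variable {K L : Type*} [Field K] [Field L] [Algebra K L] {n : ℕ}

/-- The rank norm of a vector is the rank of the linear map `K^n → L` that sends the standard basis
to its coordinates. -/
theorem rankNorm_eq_finrank_range_constr (x : Fin n → L) :
    rankNorm K x = Module.finrank K (LinearMap.range ((Pi.basisFun K (Fin n)).constr K x)) := by
  rw [Module.Basis.constr_range, rankNorm]

theorem rankNorm_le (x : Fin n → L) : rankNorm K x ≤ n :=
  (finrank_range_le_card x).trans_eq (Fintype.card_fin n)

theorem rankNorm_neg (x : Fin n → L) : rankNorm K (-x) = rankNorm K x := by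
  rw [rankNorm_eq_finrank_range_constr, rankNorm_eq_finrank_range_constr, map_neg,
    LinearMap.range_neg]

theorem rankNorm_pos {x : Fin n → L} (hx : x ≠ 0) : 0 < rankNorm K x := by
  rw [rankNorm_eq_finrank_range_constr, Module.finrank_pos_iff, Submodule.nontrivial_iff_ne_bot,
    Ne, LinearMap.range_eq_bot, LinearEquiv.map_eq_zero_iff]
  exact hx

theorem minRankDist_le_rankDist {C : Set (Fin n → L)} {x y : Fin n → L} (hx : x ∈ C) (hy : y ∈ C)
    (hxy : x ≠ y) : minRankDist K C ≤ rankDist K x y :=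
  Nat.sInf_le ⟨x, hx, y, hy, hxy, rfl⟩

theorem exists_minRankDist_eq {C : Set (Fin n → L)} (hC : C.Nontrivial) :
    ∃ x ∈ C, ∃ y ∈ C, x ≠ y ∧ minRankDist K C = rankDist K x y := by
  obtain ⟨x, hx, y, hy, hxy⟩ := hC
  exact Nat.sInf_mem (s := {d : ℕ | ∃ x ∈ C, ∃ y ∈ C, x ≠ y ∧ d = rankDist K x y})
    ⟨_, x, hx, y, hy, hxy, rfl⟩

open MeasureTheory in
/-- If all errors of the same rank are equally likely, a conditional probability given the rank is
a proportion. -/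
theorem cond_real_rankNorm_eq_div [Finite L] [MeasurableSpace L] [MeasurableSingletonClass L]
    {μ : Measure (Fin n → L)} [IsProbabilityMeasure μ] (hμ : EquiprobableOnRanks K μ) {u : ℕ}
    (hu : μ {e | rankNorm K e = u} ≠ 0) (E : Set (Fin n → L)) :
    (ProbabilityTheory.cond μ {e | rankNorm K e = u}).real E =
      (Nat.card {e : Fin n → L // rankNorm K e = u ∧ e ∈ E} : ℝ) /
        Nat.card {e : Fin n → L // rankNorm K e = u} := by
  classical
  have := Fintype.ofFinite (Fin n → L)
  obtain ⟨e₀, he₀⟩ := nonempty_of_measure_ne_zero hu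
  have hsum : ∀ s : Set (Fin n → L), (∀ e ∈ s, rankNorm K e = u) →
      μ.real s = Nat.card s * μ.real {e₀} := by
    intro s hs
    have h1 : μ.real s = ∑ e ∈ s.toFinset, μ.real {e} := by
      rw [sum_measureReal_singleton, Set.coe_toFinset]
    rw [h1, Finset.sum_congr rfl (g := fun _ => μ.real {e₀}), Finset.sum_const, nsmul_eq_mul,
      Set.toFinset_card, Nat.card_eq_fintype_card]
    intro e he
    rw [measureReal_def, measureReal_def, hμ e e₀ ((hs e (Set.mem_toFinset.1 he)).trans he₀.symm)]
  have hA := hsum {e | rankNorm K e = u} fun e he => he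
  have hAE := hsum ({e | rankNorm K e = u} ∩ E) fun e he => he.1
  have hp : μ.real {e₀} ≠ 0 := by
    intro h
    rw [h, mul_zero, measureReal_eq_zero_iff] at hA
    exact hu hA
  rw [measureReal_def, ProbabilityTheory.cond_apply (Set.toFinite _).measurableSet,
    ENNReal.toReal_mul, ENNReal.toReal_inv, ← measureReal_def, ← measureReal_def, hA, hAE,
    inv_mul_eq_div, mul_div_mul_right _ _ hp]
  rfl

end Vectors

end RankMetric

theorem mainTheorem1
    {K L : Type*} [Field K] [Field L] [Finite K] [Finite L] [Algebra K L]
    [MeasurableSpace L] [MeasurableSingletonClass L]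
    (q m n : ℕ) (hq : Nat.card K = q) (hm : Module.finrank K L = m) (hnm : n ≤ m)
    (C : Set (Fin n → L)) (hC : RankMetric.IsMRD K C)
    (t : ℕ) (ht : t = RankMetric.errorCapability K C)
    (dec : (Fin n → L) → Option (Fin n → L))
    (hdec : RankMetric.IsBoundedRankDistDecoder K C t dec)
    (μ : MeasureTheory.Measure (Fin n → L)) [MeasureTheory.IsProbabilityMeasure μ]
    (hμ : RankMetric.EquiprobableOnRanks K μ)
    (c : Fin n → L) (hc : c ∈ C)
    (u : ℕ) (hμu : μ {e | RankMetric.rankNorm K e = u} ≠ 0)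
    (hu : RankMetric.minRankDist K C ≤ u + t) :
    RankMetric.decoderErrorProb K μ dec c u
      < (q : ℝ) ^ (-((t : ℤ) ^ 2)) / (RankMetric.Kq q) ^ 2 := by
  open RankMetric in
  subst hq hm
  have hq : 2 ≤ Nat.card K := Finite.one_lt_card
  have hn : Module.finrank K (Fin n → K) = n := Module.finrank_fin_fun K
  let Φ := (Pi.basisFun K (Fin n)).constr K (M' := L)
  have hΦ : ∀ x, rankNorm K x = Module.finrank K (LinearMap.range (Φ x)) :=
    rankNorm_eq_finrank_range_constr
  have hd : 1 ≤ minRankDist K C ∧ minRankDist K C ≤ n := by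
    obtain ⟨x, -, y, -, hxy, h⟩ := exists_minRankDist_eq (K := K) hC.1
    rw [h]
    exact ⟨rankNorm_pos (sub_ne_zero.2 hxy), rankNorm_le _⟩
  have htd : 2 * t + 1 ≤ minRankDist K C := by
    rw [ht, errorCapability]
    omega
  obtain ⟨e₀, he₀⟩ := MeasureTheory.nonempty_of_measure_ne_zero hμu
  have hun : u ≤ n := he₀.symm.le.trans (rankNorm_le e₀)
  -- The wrong codewords, relative to the transmitted one.
  let X : Set ((Fin n → K) →ₗ[K] L) := {x | ∃ c' ∈ C, c' ≠ c ∧ x = Φ (c' - c)}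
  have hX : ∀ x ∈ X, ∀ y ∈ X, x ≠ y →
      minRankDist K C ≤ Module.finrank K (LinearMap.range (x - y)) := by
    rintro _ ⟨x, hx, -, rfl⟩ _ ⟨y, hy, -, rfl⟩ hxy
    rw [← map_sub, ← hΦ, sub_sub_sub_cancel_right]
    exact minRankDist_le_rankDist hx hy (by rintro rfl; exact hxy rfl)
  have hX0 : ∀ x ∈ X, minRankDist K C ≤ Module.finrank K (LinearMap.range x) := by
    rintro _ ⟨x, hx, hxc, rfl⟩
    rw [← hΦ]
    exact minRankDist_le_rankDist hx hc hxc
  have hA : Nat.card {e : Fin n → L // rankNorm K e = u} =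
      Nat.card {e : (Fin n → K) →ₗ[K] L // Module.finrank K (LinearMap.range e) = u} :=
    Nat.card_congr (Φ.toEquiv.subtypeEquiv fun e => by rw [hΦ]; rfl)
  have hB : Nat.card {e : Fin n → L // rankNorm K e = u ∧ e ∈ {e | IsDecoderError dec c (c + e)}} ≤
      Nat.card {e : (Fin n → K) →ₗ[K] L // Module.finrank K (LinearMap.range e) = u ∧
        ∃ x ∈ X, Module.finrank K (LinearMap.range (x - e)) ≤ t} := by
    have : Finite ((Fin n → K) →ₗ[K] L) := Module.finite_of_finite K
    refine Nat.card_le_card_of_injective (fun e => ⟨Φ e.1, by rw [← hΦ, e.2.1], ?_⟩)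
      fun e e' h => Subtype.ext (Φ.injective (congrArg (fun z => z.1) h))
    obtain ⟨c', hc', hne⟩ := e.2.2
    rcases hdec (c + e.1) with ⟨c'', hc'', hdist, hdec'⟩ | ⟨-, hdec'⟩
    · obtain rfl : c'' = c' := Option.some.inj (hdec'.symm.trans hc')
      refine ⟨_, ⟨c'', hc'', hne, rfl⟩, ?_⟩
      rw [← map_sub, ← hΦ, ← rankNorm_neg, show -(c'' - c - e.1) = c + e.1 - c'' by abel]
      exact hdist
    · rw [hdec'] at hc'
      exact absurd hc' (by simp)
  rw [decoderErrorProb, cond_real_rankNorm_eq_div hμ hμu, hA]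
  refine (div_le_div_of_nonneg_right (Nat.cast_le.2 hB) (Nat.cast_nonneg _)).trans_lt ?_
  exact natCard_decodable_div_lt hq hX hX0 htd (hn.symm ▸ hd.2) (hn.symm ▸ hnm) (hn.symm ▸ hun)
    ⟨⟨Φ e₀, by rw [← hΦ]; exact he₀⟩⟩
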